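/- Two devices share a channel in discrete slots $t=0,1,2,\dots$. In each slot each device transmits or idles; a device that idles receives the response $0$, a device that transmits receives $1$ (success) if the other device idles, and $2_+$ (collision) if the other device transmits too. A policy is a function $f:\{0,1,2_+\}^*\to[0,1]$ with $f(w)=0$ whenever $1$ occurs in $w$. Both devices run the same policy with independent private randomness: in slot $t$, a device whose previous responses form the word $w$ transmits with probability $f(w)$, i.e. iff $U_{k,t}<f(w)$, where $(U_{k,t})$ ($k=1,2$, $t\ge 0$) are i.i.d. uniform on $[0,1]$. Let $X_k\in\{1,2,\dots\}\cup\{\infty\}$ be one plus the index of the slot in which device $k$ succeeds ($\infty$ if there is none). A policy is optimal under the MAX objective if it minimizes $\mathbb{E}\max(X_1,X_2)\in[0,\infty]$ among all policies. The polynomial $x^3+7x^2-21x+9$ has a unique root $\alpha\approx 0.528837$ in $[0,1]$, the polynomial $4x^3-8x^2+3$ has a unique root $\beta\approx 0.785997$ in $[0,1]$, and the polynomial $3x^3-12x^2+10x-2$ has a unique root $\gamma\approx 0.299723$ in $[1/4,1/3]$. Consider the following protocol (MAX-Contention Resolution), started in Step 1. Step 1. Transmit with probability $\alpha$. If successful,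 halt; if there was a collision, repeat Step 1; otherwise proceed to Step 2. Step 2. Transmit with probability $\beta$. If successful, halt; if there was a collision, go to Step 1; otherwise proceed to Step 3. Step 3. Transmit with probability $1$. If successful, halt; otherwise go to Step 1. This protocol is an optimal policy for two devices under the MAX objective, and its expected maximum latency is $\mathbb{E}\max(X_1,X_2)=1/\gamma\approx 3.33641$. (Here $\approx$ means correct rounding to the displayed digits.) -/

import Mathlib

open MeasureTheory
open scoped ENNReal

namespace ContentionResolution

/-- Channel feedback: `idle` is the response `0`, `success` is `1`, `collision` is `2₊`. -/
inductive Response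
  | idle
  | success
  | collision

/-- A proper policy: the probability of transmitting as a function of the device's own history
(the word of its past responses, in chronological order). Once a device has succeeded it must
remain idle. -/
structure Policy where
  prob : List Response → unitInterval
  halts : ∀ w, Response.success ∈ w → prob w = 0

/-- Outcomes of a random board with `n` rows: one number in `[0,1]` for each device and slot. -/
abbrev Board (n : ℕ) : Type := Fin n × ℕ → unitInterval

/-- The law of the random board: the entries are i.i.d. uniform on `[0,1]`. -/
noncomputable def boardMeasure (n : ℕ) : Measure (Board n) :=
  Measure.infinitePi fun _ : Fin n × ℕ => (volume : Measure unitInterval)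

open Classical in
/-- The response received by device `k` when `d j` says whether device `j` transmits. -/
noncomputable def respond {n : ℕ} (d : Fin n → Prop) (k : Fin n) : Response :=
  if ¬ d k then Response.idle
  else if ∀ j, j ≠ k → ¬ d j then Response.success
  else Response.collision

/-- `history f u t k` is the history of device `k` before slot `t`, when all devices run the policy
`f`: device `k` transmits in slot `t` iff `u (k, t) < f (history of k before slot t)`. -/
noncomputable def history {n : ℕ} (f : Policy) (u : Board n) : ℕ → Fin n → List Response
  | 0, _ => []
  | t + 1, k =>
      history f u t k ++ [respond (fun j => u (j, t) < f.prob (history f u t j)) k]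

/-- Device `k` transmits in slot `t`. -/
def Transmits {n : ℕ} (f : Policy) (u : Board n) (k : Fin n) (t : ℕ) : Prop :=
  u (k, t) < f.prob (history f u t k)

/-- The response that device `k` receives at the end of slot `t`. -/
noncomputable def response {n : ℕ} (f : Policy) (u : Board n) (k : Fin n) (t : ℕ) : Response :=
  respond (fun j => Transmits f u j t) k

/-- The latency `1 + min {t | device k succeeds in slot t}`, which is `⊤` if there is no such `t`. -/
noncomputable def latency {n : ℕ} (f : Policy) (u : Board n) (k : Fin n) : ℕ∞ :=
  ⨅ (t : ℕ) (_ : response f u k t = Response.success), ((t + 1 : ℕ) : ℕ∞)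

/-- The expected cost of the policy `f`, run by `n` devices, for the cost function `T` of the
vector of latencies. -/
noncomputable def expectedCost {n : ℕ} (T : (Fin n → ℕ∞) → ℝ≥0∞) (f : Policy) : ℝ≥0∞ :=
  ∫⁻ u, T (fun k => latency f u k) ∂(boardMeasure n)

/-- The policy `f` is optimal for `n` devices and the cost function `T`. -/
def IsOptimal {n : ℕ} (T : (Fin n → ℕ∞) → ℝ≥0∞) (f : Policy) : Prop :=
  ∀ g : Policy, expectedCost T f ≤ expectedCost T g

/-- The max objective for two devices. -/
noncomputable def maxObjective (x : Fin 2 → ℕ∞) : ℝ≥0∞ :=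
  ((max (x 0) (x 1) : ℕ∞) : ℝ≥0∞)

/-- The control states of the three-step protocol. -/
inductive Step
  | step1
  | step2
  | step3
  | halted

/-- The transition of the protocol after a response of the channel: halt after a success; after a
collision go to Step 1; after idling go from Step 1 to Step 2, from Step 2 to Step 3, and from
Step 3 to Step 1. -/
def Step.next : Step → Response → Step
  | .halted, _ => .halted
  | _, .success => .halted
  | _, .collision => .step1
  | .step1, .idle => .step2
  | .step2, .idle => .step3
  | .step3, .idle => .step1

/-- The transmission probability in each state, for the parameters `α`, `β`. -/
def Step.transmitProb (α β : unitInterval) : Step → unitInterval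
  | .step1 => α
  | .step2 => β
  | .step3 => 1
  | .halted => 0

/-- The state reached from state `s` after the responses `w`. -/
def Step.run (s : Step) (w : List Response) : Step := w.foldl Step.next s

theorem Step.run_halted (w : List Response) : Step.run .halted w = .halted := by
  induction w with
  | nil => rfl
  | cons r w ih => exact ih

theorem Step.run_of_success_mem (w : List Response) (s : Step) (h : Response.success ∈ w) :
    Step.run s w = .halted := by
  induction w generalizing s with
  | nil => simp at h
  | cons r w ih =>
    rcases List.mem_cons.mp h with h | h
    · subst h
      have : Step.next s .success = .halted := by cases s <;> rfl
      change Step.run (Step.next s .success) w = _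
      rw [this, Step.run_halted]
    · exact ih (Step.next s r) h

/-- The three-step protocol with transmission probabilities `α`, `β`, `1`, started in Step 1. -/
def threeStepProtocol (α β : unitInterval) : Policy where
  prob w := Step.transmitProb α β (Step.run .step1 w)
  halts w h := by rw [Step.run_of_success_mem w .step1 h]; rfl

end ContentionResolution

namespace ContentionResolution

open ProbabilityTheory unitInterval

/-! ### The pair of histories as a Markov chain -/

/-! Collisions cut time into rounds: a collision of devices with equal histories leaves them with
equal success-free histories. Within a round a device that has not yet transmitted hears only idle,
whatever the other one does. So the first transmissions of the two devices behave like i.i.d. times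
with tail `b`: equal times are a collision, distinct times are two successes.

Lower bound (`expectedCost_ge`): let `M` be the infimum of `joint f w` over success-free `w`.
Charging `M` for each collision bounds every such `joint f w` below by the round cost of some `b`.
That cost is affine in `M`, at least `1 / γ` when `M = 1 / γ` (`roundCost_inv_ge`), and at least `1`
when `M = 0`. Hence `M < 1 / γ` would force `M ≥ M + (1 - M * γ)`, which is absurd.

The analytic core is dynamic programming. Below its cap, `tailBound` is the optimal value of a
descent `b → c → 0`. Adding a first step `1 → c` leaves a quadratic in `c` whose discriminant has
the cubic of `γ` as a factor, so its minimum is exactly the target. The optimal tail `1, 1 - α, (1 -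
α) * (1 - β) = 1 - 3 * γ, 0` is the three-step protocol.

Upper bound: `remaining` is the least solution of its one-step inequality, so the explicit potential
`protocolCost` dominates it. -/

instance : Finite Response :=
  Finite.of_surjective (fun i : Fin 3 => ![Response.idle, .success, .collision] i) (by
    rintro (_ | _ | _)
    · exact ⟨0, rfl⟩
    · exact ⟨1, rfl⟩
    · exact ⟨2, rfl⟩)

instance : MeasurableSpace Response := ⊤

instance : DiscreteMeasurableSpace Response := ⟨fun _ => trivial⟩

instance : MeasurableSpace (List Response) := ⊤

instance : DiscreteMeasurableSpace (List Response) := ⟨fun _ => trivial⟩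

instance (n : ℕ) : IsProbabilityMeasure (boardMeasure n) := by
  unfold boardMeasure; infer_instance

open Classical in
/-- The response to a device that transmits iff `a`, while the other device transmits iff `b`. -/
noncomputable def reply (a b : Prop) : Response :=
  if a then if b then .collision else .success else .idle

theorem respond_zero (d : Fin 2 → Prop) : respond d 0 = reply (d 0) (d 1) := by
  unfold respond reply
  by_cases h0 : d 0 <;> by_cases h1 : d 1 <;> simp [h0, h1, Fin.forall_fin_two]

theorem respond_one (d : Fin 2 → Prop) : respond d 1 = reply (d 1) (d 0) := by
  unfold respond reply
  by_cases h0 : d 0 <;> by_cases h1 : d 1 <;> simp [h0, h1, Fin.forall_fin_two]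

/-- The pair of histories of two devices before slot `t`. -/
noncomputable def histories (f : Policy) (u : Board 2) (t : ℕ) : List Response × List Response :=
  (history f u t 0, history f u t 1)

/-- The pair of histories after one more slot, in which the devices draw `v.1` and `v.2`. -/
noncomputable def advance (f : Policy) (h : List Response × List Response) (v : I × I) :
    List Response × List Response :=
  (h.1 ++ [reply (v.1 < f.prob h.1) (v.2 < f.prob h.2)],
    h.2 ++ [reply (v.2 < f.prob h.2) (v.1 < f.prob h.1)])

theorem histories_succ (f : Policy) (u : Board 2) (t : ℕ) :
    histories f u (t + 1) = advance f (histories f u t) (u (0, t), u (1, t)) := by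
  simp only [histories, history, advance, respond_zero, respond_one]

theorem history_congr {n : ℕ} (f : Policy) {u v : Board n} {t : ℕ}
    (h : ∀ k s, s < t → u (k, s) = v (k, s)) (k : Fin n) :
    history f u t k = history f v t k := by
  induction t generalizing k with
  | zero => rfl
  | succ t ih =>
    have ih' := fun k => ih (fun k s hs => h k s (by omega)) k
    simp only [history, ih', h _ t (Nat.lt_succ_self t)]

theorem measurable_reply {Ω : Type*} [MeasurableSpace Ω] {a b : Ω → Prop}
    (ha : MeasurableSet {ω | a ω}) (hb : MeasurableSet {ω | b ω}) :
    Measurable fun ω => reply (a ω) (b ω) := by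
  classical
  unfold reply
  convert Measurable.ite ha (Measurable.ite hb measurable_const measurable_const) measurable_const

theorem measurable_append {Ω : Type*} [MeasurableSpace Ω] {x : Ω → List Response}
    {r : Ω → Response} (hx : Measurable x) (hr : Measurable r) :
    Measurable fun ω => x ω ++ [r ω] :=
  (Measurable.of_discrete (f := fun p : List Response × Response => p.1 ++ [p.2])).comp
    (hx.prodMk hr)

theorem measurableSet_transmit {Ω : Type*} [MeasurableSpace Ω] (f : Policy) {x : Ω → List Response}
    {v : Ω → I} (hx : Measurable x) (hv : Measurable v) :
    MeasurableSet {ω | v ω < f.prob (x ω)} :=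
  measurableSet_lt hv ((Measurable.of_discrete (f := f.prob)).comp hx)

theorem measurable_advance (f : Policy) :
    Measurable fun p : (List Response × List Response) × (I × I) => advance f p.1 p.2 := by
  have h1 : MeasurableSet {p : (List Response × List Response) × (I × I) | p.2.1 < f.prob p.1.1} :=
    measurableSet_transmit f (by fun_prop) (by fun_prop)
  have h2 : MeasurableSet {p : (List Response × List Response) × (I × I) | p.2.2 < f.prob p.1.2} :=
    measurableSet_transmit f (by fun_prop) (by fun_prop)
  exact (measurable_append (by fun_prop) (measurable_reply h1 h2)).prodMk
    (measurable_append (by fun_prop) (measurable_reply h2 h1))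

theorem measurable_histories (f : Policy) (t : ℕ) : Measurable fun u => histories f u t := by
  induction t with
  | zero => exact (measurable_const : Measurable fun _ : Board 2 => (([], []) : List Response × List Response))
  | succ t ih =>
    simp only [histories_succ]
    exact (measurable_advance f).comp (ih.prodMk (by fun_prop))

/-- The histories before slot `t` are independent of the numbers drawn in slot `t`. -/
theorem indepFun_histories (f : Policy) (t : ℕ) :
    IndepFun (fun u => histories f u t) (fun u : Board 2 => (u (0, t), u (1, t)))
      (boardMeasure 2) := by
  classical
  have hi : iIndepFun (fun (i : Fin 2 × ℕ) (u : Board 2) => u i) (boardMeasure 2) :=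
    iIndepFun_infinitePi (X := fun _ x => x) (fun _ => measurable_id)
  -- The histories before slot `t` read only the entries in `S`; the draws of slot `t` are the
  -- entries in `S'`.
  let S : Finset (Fin 2 × ℕ) := Finset.univ ×ˢ Finset.range t
  let S' : Finset (Fin 2 × ℕ) := Finset.univ ×ˢ {t}
  have hS : Disjoint S S' := by
    rw [Finset.disjoint_left]
    simp only [S, S', Finset.mem_product, Finset.mem_range, Finset.mem_singleton]
    omega
  have key := hi.indepFun_finset S S' hS (fun i => measurable_pi_apply i)
  -- The padding value `0` is never read before slot `t`.
  let ext : (S → I) → Board 2 := fun v i => if h : i ∈ S then v ⟨i, h⟩ else 0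
  have hext : Measurable ext := by
    refine measurable_pi_lambda _ fun i => ?_
    by_cases h : i ∈ S
    · simpa [ext, h] using measurable_pi_apply _
    · simp [ext, h]
  have h0 : ((0 : Fin 2), t) ∈ S' := by simp [S']
  have h1 : ((1 : Fin 2), t) ∈ S' := by simp [S']
  have := key.comp ((measurable_histories f t).comp hext)
    (ψ := fun v : S' → I => (v ⟨_, h0⟩, v ⟨_, h1⟩)) (by fun_prop)
  convert this using 1
  swap
  · rfl
  refine funext fun u => ?_
  have hc : ∀ k, history f u t k = history f (ext fun i : S => u i) t k := by
    refine history_congr f fun k s hs => ?_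
    have : (k, s) ∈ S := by simp [S, hs]
    simp [ext, this]
  simp [histories, Function.comp, hc]

theorem lintegral_ite_lt (p : I) (A B : ℝ≥0∞) :
    ∫⁻ v : I, (if v < p then A else B) = toNNReal p * A + toNNReal (σ p) * B := by
  have h : (fun v : I => if v < p then A else B)
      = fun v => (Set.Iio p).indicator (fun _ => A) v + (Set.Ici p).indicator (fun _ => B) v := by
    funext v
    by_cases hv : v < p
    · simp [hv]
    · simp [hv, not_lt.1 hv]
  have hp : ENNReal.ofReal (p : ℝ) = toNNReal p := by
    rw [← coe_toNNReal, ENNReal.ofReal_coe_nnreal]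
  have hq : ENNReal.ofReal (1 - (p : ℝ)) = toNNReal (σ p) := by
    rw [← coe_symm_eq, ← coe_toNNReal, ENNReal.ofReal_coe_nnreal]
  rw [h, lintegral_add_left (measurable_const.indicator measurableSet_Iio),
    lintegral_indicator_const measurableSet_Iio, lintegral_indicator_const measurableSet_Ici,
    unitInterval.volume_Iio, unitInterval.volume_Ici, hp, hq, mul_comm, mul_comm B]

/-- The transition operator of the chain of pairs of histories. -/
noncomputable def transition (f : Policy) (φ : List Response × List Response → ℝ≥0∞)
    (h : List Response × List Response) : ℝ≥0∞ :=
  toNNReal (f.prob h.1) * (toNNReal (f.prob h.2) * φ (h.1 ++ [.collision], h.2 ++ [.collision])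
      + toNNReal (σ (f.prob h.2)) * φ (h.1 ++ [.success], h.2 ++ [.idle]))
    + toNNReal (σ (f.prob h.1)) * (toNNReal (f.prob h.2) * φ (h.1 ++ [.idle], h.2 ++ [.success])
      + toNNReal (σ (f.prob h.2)) * φ (h.1 ++ [.idle], h.2 ++ [.idle]))

theorem lintegral_advance (f : Policy) (φ : List Response × List Response → ℝ≥0∞)
    (h : List Response × List Response) :
    ∫⁻ v, φ (advance f h v) ∂((volume : Measure I).prod (volume : Measure I))
      = transition f φ h := by
  have hm : Measurable fun v => φ (advance f h v) :=
    (Measurable.of_discrete (f := φ)).comp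
      ((measurable_advance f).comp (measurable_prodMk_left (x := h)))
  rw [lintegral_prod _ hm.aemeasurable]
  have inner : ∀ x : I, ∫⁻ y : I, φ (advance f h (x, y)) =
      if x < f.prob h.1 then
        toNNReal (f.prob h.2) * φ (h.1 ++ [.collision], h.2 ++ [.collision])
          + toNNReal (σ (f.prob h.2)) * φ (h.1 ++ [.success], h.2 ++ [.idle])
      else toNNReal (f.prob h.2) * φ (h.1 ++ [.idle], h.2 ++ [.success])
          + toNNReal (σ (f.prob h.2)) * φ (h.1 ++ [.idle], h.2 ++ [.idle]) := by
    intro x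
    split_ifs with hx <;> rw [← lintegral_ite_lt] <;> refine lintegral_congr fun y => ?_ <;>
      by_cases hy : y < f.prob h.2 <;> simp [advance, reply, hx, hy]
  simp only [inner]
  exact lintegral_ite_lt _ _ _

/-- Independence makes the joint law of past and present draws a product, so Fubini integrates out
slot `t` first. -/
theorem lintegral_histories_succ (f : Policy) (t : ℕ)
    (φ : List Response × List Response → ℝ≥0∞) :
    ∫⁻ u, φ (histories f u (t + 1)) ∂boardMeasure 2
      = ∫⁻ u, transition f φ (histories f u t) ∂boardMeasure 2 := by
  have hU : Measurable fun u : Board 2 => (u (0, t), u (1, t)) := by fun_prop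
  have hH := measurable_histories f t
  have hlaw : (boardMeasure 2).map (fun u : Board 2 => (u (0, t), u (1, t)))
      = (volume : Measure I).prod volume :=
    Measure.infinitePi_map_eval_prod (P := fun _ : Fin 2 × ℕ => (volume : Measure I))
      (i := (0, t)) (j := (1, t)) (by simp)
  have hprod := (indepFun_iff_map_prod_eq_prod_map_map hH.aemeasurable hU.aemeasurable).1
    (indepFun_histories f t)
  rw [hlaw] at hprod
  have hm : Measurable fun p : (List Response × List Response) × (I × I) => φ (advance f p.1 p.2) :=
    (Measurable.of_discrete (f := φ)).comp (measurable_advance f)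
  simp only [histories_succ]
  rw [← lintegral_map (f := fun p : (List Response × List Response) × (I × I) =>
      φ (advance f p.1 p.2)) hm (hH.prodMk hU), hprod, lintegral_prod _ hm.aemeasurable]
  simp only [lintegral_advance]
  exact lintegral_map .of_discrete hH

theorem lintegral_histories (f : Policy) (t : ℕ) (φ : List Response × List Response → ℝ≥0∞) :
    ∫⁻ u, φ (histories f u t) ∂boardMeasure 2 = (transition f)^[t] φ ([], []) := by
  induction t generalizing φ with
  | zero => simp [histories, history]
  | succ t ih => rw [lintegral_histories_succ, ih, Function.iterate_succ_apply]

/-! ### The expected maximum latency as a potential of the chain -/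

open Classical in
/-- The cost of a slot: `1` as long as some device has not succeeded. -/
noncomputable def slotCost (h : List Response × List Response) : ℝ≥0∞ :=
  if .success ∈ h.1 ∧ .success ∈ h.2 then 0 else 1

theorem success_mem_history_iff {n : ℕ} (f : Policy) (u : Board n) (t : ℕ) (k : Fin n) :
    .success ∈ history f u t k ↔ ∃ s < t, response f u k s = .success := by
  induction t with
  | zero => simp [history]
  | succ t ih =>
    have : history f u (t + 1) k = history f u t k ++ [response f u k t] := rfl
    rw [this, List.mem_append, ih, List.mem_singleton]
    constructor
    · rintro (⟨s, hs, h⟩ | h)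
      · exact ⟨s, by omega, h⟩
      · exact ⟨t, by omega, h.symm⟩
    · rintro ⟨s, hs, h⟩
      rcases Nat.lt_succ_iff_lt_or_eq.1 hs with hs | rfl
      · exact .inl ⟨s, hs, h⟩
      · exact .inr h.symm

theorem lt_latency_iff {n : ℕ} (f : Policy) (u : Board n) (t : ℕ) (k : Fin n) :
    (t : ℕ∞) < latency f u k ↔ .success ∉ history f u t k := by
  rw [success_mem_history_iff, ← ENat.add_one_le_iff (ENat.natCast_ne_top t), latency]
  simp only [le_iInf_iff, not_exists, not_and]
  refine forall_congr' fun s => ⟨fun h hs hr => ?_, fun h hr => ?_⟩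
  · have := h hr
    norm_cast at this
    omega
  · have : ¬ s < t := fun hs => h hs hr
    norm_cast
    omega

theorem ENat_toENNReal_eq_tsum (N : ℕ∞) :
    (N : ℝ≥0∞) = ∑' t : ℕ, if (t : ℕ∞) < N then 1 else 0 := by
  induction N using ENat.recTopCoe with
  | top => simp
  | coe n =>
    rw [tsum_eq_sum (s := Finset.range n) (by simp)]
    simp only [Nat.cast_lt]
    rw [Finset.sum_congr rfl (fun t ht => if_pos (Finset.mem_range.1 ht))]
    simp

theorem maxObjective_latency (f : Policy) (u : Board 2) :
    maxObjective (fun k => latency f u k) = ∑' t, slotCost (histories f u t) := by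
  rw [maxObjective, ENat_toENNReal_eq_tsum]
  refine tsum_congr fun t => ?_
  have h : (t : ℕ∞) < max (latency f u 0) (latency f u 1) ↔
      ¬(.success ∈ (histories f u t).1 ∧ .success ∈ (histories f u t).2) := by
    rw [lt_max_iff, lt_latency_iff, lt_latency_iff, histories]
    tauto
  by_cases hs : .success ∈ (histories f u t).1 ∧ .success ∈ (histories f u t).2
  · rw [if_neg (by rwa [h, not_not]), slotCost, if_pos hs]
  · rw [if_pos (h.2 hs), slotCost, if_neg hs]

/-- The expected number of slots, from the pair of histories `h` on, until both devices have
succeeded. -/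
noncomputable def remaining (f : Policy) (h : List Response × List Response) : ℝ≥0∞ :=
  ∑' t, (transition f)^[t] slotCost h

theorem expectedCost_eq_remaining (f : Policy) :
    expectedCost maxObjective f = remaining f ([], []) := by
  simp only [expectedCost, maxObjective_latency]
  rw [lintegral_tsum (f := fun t u => slotCost (histories f u t)) fun t =>
    ((Measurable.of_discrete (f := slotCost)).comp (measurable_histories f t)).aemeasurable]
  exact tsum_congr fun t => lintegral_histories f t slotCost

theorem transition_tsum (f : Policy) (φ : ℕ → List Response × List Response → ℝ≥0∞)
    (h : List Response × List Response) :
    transition f (fun h => ∑' t, φ t h) h = ∑' t, transition f (φ t) h := by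
  simp only [transition, ENNReal.tsum_add, ENNReal.tsum_mul_left]

theorem transition_mono (f : Policy) {φ ψ : List Response × List Response → ℝ≥0∞}
    (hφ : ∀ h, φ h ≤ ψ h) (h : List Response × List Response) :
    transition f φ h ≤ transition f ψ h := by
  unfold transition
  exact add_le_add
    (mul_le_mul_right (add_le_add (mul_le_mul_right (hφ _) _) (mul_le_mul_right (hφ _) _)) _)
    (mul_le_mul_right (add_le_add (mul_le_mul_right (hφ _) _) (mul_le_mul_right (hφ _) _)) _)

theorem remaining_eq (f : Policy) (h : List Response × List Response) :
    remaining f h = slotCost h + transition f (remaining f) h := by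
  have : transition f (remaining f) h = ∑' t, (transition f)^[t + 1] slotCost h := by
    simp only [Function.iterate_succ_apply']
    exact transition_tsum f (fun t => (transition f)^[t] slotCost) h
  rw [this, remaining,
    tsum_eq_zero_add' (f := fun t => (transition f)^[t] slotCost h) ENNReal.summable]
  rfl

/-- Each partial sum of the series `remaining` stays below `v` by induction, since `transition f` is
additive and monotone. -/
theorem remaining_le_of_superharmonic (f : Policy) {v : List Response × List Response → ℝ≥0∞}
    (hv : ∀ h, slotCost h + transition f v h ≤ v h) (h : List Response × List Response) :
    remaining f h ≤ v h := by
  have key : ∀ n h, ∑ t ∈ Finset.range n, (transition f)^[t] slotCost h ≤ v h := by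
    intro n
    induction n with
    | zero => simp
    | succ n ih =>
      intro h
      refine le_trans ?_ (hv h)
      rw [Finset.sum_range_succ']
      have : ∑ t ∈ Finset.range n, (transition f)^[t + 1] slotCost h
          = transition f (fun h => ∑ t ∈ Finset.range n, (transition f)^[t] slotCost h) h := by
        simp only [transition, Finset.sum_add_distrib, ← Finset.mul_sum,
          Function.iterate_succ_apply']
      rw [this, add_comm]
      exact add_le_add le_rfl (transition_mono f ih h)
  exact ENNReal.tsum_le_of_sum_range_le fun n => key n h

/-! ### The three cubics -/

theorem alphaCubic_strictAnti {x y : ℝ} (hx : 0 ≤ x) (hxy : x < y) (hy : y ≤ 1) :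
    y ^ 3 + 7 * y ^ 2 - 21 * y + 9 < x ^ 3 + 7 * x ^ 2 - 21 * x + 9 := by
  -- The difference quotient of the cubic; its constant sign gives monotonicity.
  have h : x ^ 2 + x * y + y ^ 2 + 7 * (x + y) - 21 < 0 := by nlinarith
  nlinarith [mul_neg_of_pos_of_neg (sub_pos.2 hxy) h]

theorem betaCubic_strictAnti {x y : ℝ} (hx : 0 ≤ x) (hxy : x < y) (hy : y ≤ 1) :
    4 * y ^ 3 - 8 * y ^ 2 + 3 < 4 * x ^ 3 - 8 * x ^ 2 + 3 := by
  have h : 4 * (x ^ 2 + x * y + y ^ 2) - 8 * (x + y) < 0 := by nlinarith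
  nlinarith [mul_neg_of_pos_of_neg (sub_pos.2 hxy) h]

theorem gammaCubic_strictMono {x y : ℝ} (hx : 1 / 4 ≤ x) (hxy : x < y) (hy : y ≤ 1 / 3) :
    3 * x ^ 3 - 12 * x ^ 2 + 10 * x - 2 < 3 * y ^ 3 - 12 * y ^ 2 + 10 * y - 2 := by
  have h : 0 < 3 * (x ^ 2 + x * y + y ^ 2) - 12 * (x + y) + 10 := by nlinarith
  nlinarith [mul_pos (sub_pos.2 hxy) h]

theorem existsUnique_alpha :
    ∃! x : ℝ, x ∈ Set.Icc (0 : ℝ) 1 ∧ x ^ 3 + 7 * x ^ 2 - 21 * x + 9 = 0 := by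
  obtain ⟨x, hx, h⟩ := intermediate_value_Icc' (zero_le_one' ℝ)
    (f := fun x : ℝ => x ^ 3 + 7 * x ^ 2 - 21 * x + 9) (by fun_prop)
    (show (0 : ℝ) ∈ Set.Icc _ _ by norm_num)
  refine ⟨x, ⟨hx, h⟩, fun y ⟨hy, h'⟩ => ?_⟩
  simp only at h
  rcases lt_trichotomy y x with hl | rfl | hl
  · linarith [alphaCubic_strictAnti hy.1 hl hx.2]
  · rfl
  · linarith [alphaCubic_strictAnti hx.1 hl hy.2]

theorem existsUnique_beta :
    ∃! x : ℝ, x ∈ Set.Icc (0 : ℝ) 1 ∧ 4 * x ^ 3 - 8 * x ^ 2 + 3 = 0 := by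
  obtain ⟨x, hx, h⟩ := intermediate_value_Icc' (zero_le_one' ℝ)
    (f := fun x : ℝ => 4 * x ^ 3 - 8 * x ^ 2 + 3) (by fun_prop)
    (show (0 : ℝ) ∈ Set.Icc _ _ by norm_num)
  refine ⟨x, ⟨hx, h⟩, fun y ⟨hy, h'⟩ => ?_⟩
  simp only at h
  rcases lt_trichotomy y x with hl | rfl | hl
  · linarith [betaCubic_strictAnti hy.1 hl hx.2]
  · rfl
  · linarith [betaCubic_strictAnti hx.1 hl hy.2]

theorem existsUnique_gamma :
    ∃! x : ℝ, x ∈ Set.Icc (1 / 4 : ℝ) (1 / 3) ∧ 3 * x ^ 3 - 12 * x ^ 2 + 10 * x - 2 = 0 := by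
  obtain ⟨x, hx, h⟩ := intermediate_value_Icc (show (1 / 4 : ℝ) ≤ 1 / 3 by norm_num)
    (f := fun x : ℝ => 3 * x ^ 3 - 12 * x ^ 2 + 10 * x - 2) (by fun_prop)
    (show (0 : ℝ) ∈ Set.Icc _ _ by norm_num)
  refine ⟨x, ⟨hx, h⟩, fun y ⟨hy, h'⟩ => ?_⟩
  simp only at h
  rcases lt_trichotomy y x with hl | rfl | hl
  · linarith [gammaCubic_strictMono hy.1 hl hx.2]
  · rfl
  · linarith [gammaCubic_strictMono hx.1 hl hy.2]

theorem alpha_approx {x : ℝ} (hx : x ∈ Set.Icc (0 : ℝ) 1)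
    (h : x ^ 3 + 7 * x ^ 2 - 21 * x + 9 = 0) : |x - 0.528837| < 0.0000005 := by
  rw [abs_lt]
  constructor
  · by_contra hc
    rcases (show x ≤ 0.5288365 by linarith).lt_or_eq with hl | rfl
    · linarith [alphaCubic_strictAnti hx.1 hl (by norm_num)]
    · norm_num at h
  · by_contra hc
    rcases (show 0.5288375 ≤ x by linarith).lt_or_eq with hl | rfl
    · linarith [alphaCubic_strictAnti (by norm_num) hl hx.2]
    · norm_num at h

theorem beta_approx {x : ℝ} (hx : x ∈ Set.Icc (0 : ℝ) 1)
    (h : 4 * x ^ 3 - 8 * x ^ 2 + 3 = 0) : |x - 0.785997| < 0.0000005 := by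
  rw [abs_lt]
  constructor
  · by_contra hc
    rcases (show x ≤ 0.7859965 by linarith).lt_or_eq with hl | rfl
    · linarith [betaCubic_strictAnti hx.1 hl (by norm_num)]
    · norm_num at h
  · by_contra hc
    rcases (show 0.7859975 ≤ x by linarith).lt_or_eq with hl | rfl
    · linarith [betaCubic_strictAnti (by norm_num) hl hx.2]
    · norm_num at h

/-- Six digits of `γ` would be too coarse for the stated digits of `1 / γ`, because inversion
magnifies errors about elevenfold. -/
theorem gamma_mem_Ioo {x : ℝ} (hx : x ∈ Set.Icc (1 / 4 : ℝ) (1 / 3))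
    (h : 3 * x ^ 3 - 12 * x ^ 2 + 10 * x - 2 = 0) : x ∈ Set.Ioo (0.2997231 : ℝ) 0.2997232 := by
  constructor
  · by_contra hc
    rcases (not_lt.1 hc).lt_or_eq with hl | rfl
    · linarith [gammaCubic_strictMono hx.1 hl (by norm_num)]
    · norm_num at h
  · by_contra hc
    rcases (not_lt.1 hc).lt_or_eq with hl | rfl
    · linarith [gammaCubic_strictMono (by norm_num) hl hx.2]
    · norm_num at h

/-- The right-hand side is `1` minus the optimal `b 1` of the first step; modulo the cubic of `γ` it
is a root of the cubic of `α`. -/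
theorem alpha_eq {α γ : ℝ} (hα : α ∈ Set.Icc (0 : ℝ) 1) (h : α ^ 3 + 7 * α ^ 2 - 21 * α + 9 = 0)
    (hγ : γ ∈ Set.Ioo (0.2997231 : ℝ) 0.2997232)
    (hγ0 : 3 * γ ^ 3 - 12 * γ ^ 2 + 10 * γ - 2 = 0) : α = -1 + 6 * γ - 3 * γ ^ 2 := by
  obtain ⟨h1, h2⟩ := hγ
  refine existsUnique_alpha.unique ⟨hα, h⟩ ⟨⟨by nlinarith, by nlinarith⟩, ?_⟩
  linear_combination (-18 + 6 * γ + 18 * γ ^ 2 - 9 * γ ^ 3) * hγ0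

theorem beta_eq {β γ : ℝ} (hβ : β ∈ Set.Icc (0 : ℝ) 1) (h : 4 * β ^ 3 - 8 * β ^ 2 + 3 = 0)
    (hγ : γ ∈ Set.Ioo (0.2997231 : ℝ) 0.2997232)
    (hγ0 : 3 * γ ^ 3 - 12 * γ ^ 2 + 10 * γ - 2 = 0) : β = 2 - 9 / 2 * γ + 3 / 2 * γ ^ 2 := by
  obtain ⟨h1, h2⟩ := hγ
  refine existsUnique_beta.unique ⟨hβ, h⟩ ⟨⟨by nlinarith, by nlinarith⟩, ?_⟩
  linear_combination (-3 / 2 + 57 / 2 * γ - 45 / 2 * γ ^ 2 + 9 / 2 * γ ^ 3) * hγ0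

/-! ### Lower bound for one round

A round ends with a collision or when both devices have succeeded. If `b k` is the probability that
a device has not transmitted in the first `k` slots of the round, the round costs
`∑ (2 * b k - b k ^ 2)` and ends with a collision with probability `∑ (b k - b (k + 1)) ^ 2`. -/

/-- A lower bound for `∑ ((b k - b (k + 1)) ^ 2 + γ * (2 * b (k + 1) - b (k + 1) ^ 2))` over all
sequences decreasing from `b` to zero. -/
noncomputable def tailBound (γ b : ℝ) : ℝ :=
  min b (4 / 5) ^ 2 - max (min b (4 / 5) - γ) 0 ^ 2 / (2 - γ)

theorem tailBound_le_sq {γ b : ℝ} (hγ : γ < 1) (hb : 0 ≤ b) : tailBound γ b ≤ b ^ 2 := by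
  have h1 : min b (4 / 5) ^ 2 ≤ b ^ 2 :=
    pow_le_pow_left₀ (le_min hb (by norm_num)) (min_le_left _ _) 2
  have h2 : 0 ≤ max (min b (4 / 5) - γ) 0 ^ 2 / (2 - γ) := by
    have : 0 < 2 - γ := by linarith
    positivity
  unfold tailBound
  linarith

theorem tailBound_of_le {γ b : ℝ} (hγ : γ < 4 / 5) (hb : b ≤ γ) : tailBound γ b = b ^ 2 := by
  rw [tailBound, min_eq_left (by linarith), max_eq_right (by linarith)]
  simp

theorem tailBound_of_mem_Icc {γ b : ℝ} (hb : γ ≤ b) (hb' : b ≤ 4 / 5) :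
    tailBound γ b = b ^ 2 - (b - γ) ^ 2 / (2 - γ) := by
  rw [tailBound, min_eq_left hb', max_eq_left (by linarith)]

theorem tailBound_of_ge {γ b : ℝ} (hb : 4 / 5 ≤ b) : tailBound γ b = tailBound γ (4 / 5) := by
  rw [tailBound, tailBound, min_eq_right hb, min_self]

/-- For `c ≤ γ ≤ b` the slack is a square, vanishing at `c = (b - γ) / (2 - γ)`. For `c ≥ γ` it
factors. -/
theorem tailBound_le_of_le {γ b c : ℝ} (hγ : γ ∈ Set.Ioo (0.2997231 : ℝ) 0.2997232)
    (hc : 0 ≤ c) (hcb : c ≤ b) (hb : b ≤ 4 / 5) :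
    tailBound γ b ≤ (b - c) ^ 2 + γ * (2 * c - c ^ 2) + tailBound γ c := by
  obtain ⟨h1, h2⟩ := hγ
  have hs : 0 < 2 - γ := by linarith
  rcases le_total b γ with hbγ | hbγ
  · rw [tailBound_of_le (by linarith) hbγ, tailBound_of_le (by linarith) (hcb.trans hbγ)]
    nlinarith [mul_nonneg hc (sub_nonneg.2 hbγ), mul_nonneg hs.le (sq_nonneg c)]
  rw [tailBound_of_mem_Icc hbγ hb]
  rcases le_total c γ with hcγ | hcγ
  · rw [tailBound_of_le (by linarith) hcγ]
    have : 0 ≤ ((2 - γ) * c - (b - γ)) ^ 2 / (2 - γ) := by positivity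
    have e : ((2 - γ) * c - (b - γ)) ^ 2 / (2 - γ)
        = (2 - γ) * c ^ 2 - 2 * (b - γ) * c + (b - γ) ^ 2 / (2 - γ) := by
      field_simp
      ring
    linarith
  · rw [tailBound_of_mem_Icc hcγ (hcb.trans hb)]
    -- At `c = γ` both factors equal `γ * (3 - γ) - b`. The cap `4 / 5` lies just below `γ * (3 - γ)
    -- ≈ 0.809`.
    have f1 : 0 ≤ (1 - γ) * c + 2 * γ - b := by nlinarith
    have f2 : 0 ≤ (3 - γ) * c - b := by nlinarith
    have : 0 ≤ ((1 - γ) * c + 2 * γ - b) * ((3 - γ) * c - b) / (2 - γ) := by positivity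
    have e : ((1 - γ) * c + 2 * γ - b) * ((3 - γ) * c - b) / (2 - γ)
        = (2 - γ) * c ^ 2 - 2 * (b - γ) * c + (b - γ) ^ 2 / (2 - γ)
          - (c - γ) ^ 2 / (2 - γ) := by
      field_simp
      ring
    linarith

theorem tailBound_le_step {γ b c : ℝ} (hγ : γ ∈ Set.Ioo (0.2997231 : ℝ) 0.2997232)
    (hc : 0 ≤ c) (hcb : c ≤ b) (hb : b ≤ 1) :
    tailBound γ b ≤ (b - c) ^ 2 + γ * (2 * c - c ^ 2) + tailBound γ c := by
  rcases le_total b (4 / 5) with h | h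
  · exact tailBound_le_of_le hγ hc hcb h
  have hγ0 : 0 < γ := by linarith [hγ.1]
  rw [tailBound_of_ge h]
  rcases le_total c (4 / 5) with h' | h'
  · have := tailBound_le_of_le hγ hc h' le_rfl
    nlinarith
  · rw [tailBound_of_ge h']
    have : 0 ≤ γ * (2 * c - c ^ 2) := mul_nonneg hγ0.le (by nlinarith)
    nlinarith [sq_nonneg (b - c)]

/-- In the middle range the slack is a multiple of a square, by the cubic of `γ`, with equality at
`c = 1 - α`. The outer ranges have room to spare. -/
theorem one_sub_le_first_step {γ c : ℝ} (hγ : γ ∈ Set.Ioo (0.2997231 : ℝ) 0.2997232)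
    (hγ0 : 3 * γ ^ 3 - 12 * γ ^ 2 + 10 * γ - 2 = 0) :
    1 - γ ≤ (1 - c) ^ 2 + γ * (2 * c - c ^ 2) + tailBound γ c := by
  obtain ⟨h1, h2⟩ := hγ
  have hs : 0 < 2 - γ := by linarith
  rcases le_total c γ with hcγ | hcγ
  · rw [tailBound_of_le (by linarith) hcγ]
    have f : 0 ≤ -1 + 4 * γ - 2 * γ ^ 2 := by nlinarith
    have : 0 ≤ (((2 - γ) * c - (1 - γ)) ^ 2 + (-1 + 4 * γ - 2 * γ ^ 2)) / (2 - γ) := by positivity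
    have e : (((2 - γ) * c - (1 - γ)) ^ 2 + (-1 + 4 * γ - 2 * γ ^ 2)) / (2 - γ)
        = γ - 2 * (1 - γ) * c + (2 - γ) * c ^ 2 := by
      field_simp
      ring
    linarith
  rcases le_total c (4 / 5) with hc | hc
  · rw [tailBound_of_mem_Icc hcγ hc]
    have f1 : 0 < 1 - γ := by linarith
    have f2 : 0 < 3 - γ := by linarith
    have : 0 ≤ (1 - γ) * (3 - γ) * (c - (2 - 6 * γ + 3 * γ ^ 2)) ^ 2 / (2 - γ) := by positivity
    have e : (1 - γ) * (3 - γ) * (c - (2 - 6 * γ + 3 * γ ^ 2)) ^ 2 / (2 - γ)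
        = γ - 2 * (1 - γ) * c + (2 - γ) * c ^ 2 - (c - γ) ^ 2 / (2 - γ) := by
      field_simp
      linear_combination (-2 * c * (γ - 2) + (-6 + 15 * γ - 12 * γ ^ 2 + 3 * γ ^ 3)) * hγ0
    linarith
  · rw [tailBound_of_ge hc, tailBound_of_mem_Icc (by linarith) le_rfl]
    have f1 : (4 / 5 - γ) ^ 2 / (2 - γ) ≤ 1 / 5 := by
      rw [div_le_iff₀ hs]
      nlinarith
    nlinarith [mul_nonneg (show 0 ≤ 1 - γ by linarith) (sq_nonneg (1 - c))]

/-- The partial cost of a round in which each collision is charged `m`. -/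
noncomputable def roundCost (m : ℝ) (b : ℕ → ℝ) (n : ℕ) : ℝ :=
  ∑ k ∈ Finset.range n, (b k ^ 2 + 2 * (1 - b k) * b k + (b k - b (k + 1)) ^ 2 * m)

theorem roundCost_inv_ge {γ : ℝ} (hγ : γ ∈ Set.Ioo (0.2997231 : ℝ) 0.2997232)
    (hγ0 : 3 * γ ^ 3 - 12 * γ ^ 2 + 10 * γ - 2 = 0) {b : ℕ → ℝ} (hb0 : b 0 = 1)
    (hb : Antitone b) (hbn : ∀ n, 0 ≤ b n) (n : ℕ) :
    1 - 3 * b (n + 1) ≤ γ * roundCost γ⁻¹ b (n + 1) := by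
  have hγp : 0 < γ := by linarith [hγ.1]
  have hb1 : ∀ n, b n ≤ 1 := fun n => hb0 ▸ hb (Nat.zero_le n)
  -- The slot cost of `b (n + 1)` is not yet in `roundCost γ⁻¹ b (n + 1)`, but `tailBound` starts
  -- after it, hence the extra term.
  have key : ∀ n, 1 - tailBound γ (b (n + 1)) ≤
      γ * roundCost γ⁻¹ b (n + 1) + γ * (2 * b (n + 1) - b (n + 1) ^ 2) := by
    intro n
    induction n with
    | zero =>
      have := one_sub_le_first_step (c := b 1) hγ hγ0
      have e : γ * roundCost γ⁻¹ b 1 = γ + (1 - b 1) ^ 2 := by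
        simp [roundCost, hb0]
        field_simp
      simp only [zero_add, e]
      linarith
    | succ n ih =>
      have := tailBound_le_step hγ (hbn (n + 2)) (hb (Nat.le_succ (n + 1))) (hb1 (n + 1))
      have e : γ * roundCost γ⁻¹ b (n + 2) = γ * roundCost γ⁻¹ b (n + 1)
          + γ * (2 * b (n + 1) - b (n + 1) ^ 2) + (b (n + 1) - b (n + 2)) ^ 2 := by
        rw [roundCost, Finset.sum_range_succ, ← roundCost]
        field_simp
        ring
      simp only [add_assoc, Nat.reduceAdd] at this e ih ⊢
      linarith
  have h1 := tailBound_le_sq (γ := γ) (by linarith [hγ.2]) (hbn (n + 1))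
  have h2 : b (n + 1) ^ 2 ≤ b (n + 1) := by nlinarith [hb1 (n + 1), hbn (n + 1)]
  have h3 : γ * (2 * b (n + 1) - b (n + 1) ^ 2) ≤ 2 * b (n + 1) := by
    nlinarith [hγ.2, hbn (n + 1), sq_nonneg (b (n + 1))]
  linarith [key n]

theorem roundCost_zero_ge {b : ℕ → ℝ} (hb0 : b 0 = 1) (hb : Antitone b) (hbn : ∀ n, 0 ≤ b n)
    (n : ℕ) : 1 ≤ roundCost 0 b (n + 1) := by
  have hb1 : ∀ n, b n ≤ 1 := fun n => hb0 ▸ hb (Nat.zero_le n)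
  have : ∀ k ∈ Finset.range (n + 1),
      0 ≤ b k ^ 2 + 2 * (1 - b k) * b k + (b k - b (k + 1)) ^ 2 * 0 := fun k _ => by
    nlinarith [mul_nonneg (sub_nonneg.2 (hb1 k)) (hbn k), sq_nonneg (b k)]
  refine le_trans ?_ (Finset.single_le_sum this (Finset.mem_range.2 n.succ_pos))
  simp [hb0]

theorem roundCost_ge_mul {m : ℝ} (hm : 0 ≤ m) {b : ℕ → ℝ} (hb0 : b 0 = 1) (hb : Antitone b)
    (hbn : ∀ n, 0 ≤ b n) (n : ℕ) : n * b n ≤ roundCost m b n := by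
  have hb1 : ∀ n, b n ≤ 1 := fun n => hb0 ▸ hb (Nat.zero_le n)
  have hsum : ∑ _k ∈ Finset.range n, b n = n * b n := by simp
  rw [← hsum, roundCost]
  refine Finset.sum_le_sum fun k hk => ?_
  have h1 : b n ≤ b k := hb (Finset.mem_range.1 hk).le
  nlinarith [mul_nonneg (sub_nonneg.2 (hb1 k)) (hbn k), mul_nonneg (sq_nonneg (b k - b (k + 1))) hm]

theorem roundCost_ge {γ m : ℝ} (hγ : γ ∈ Set.Ioo (0.2997231 : ℝ) 0.2997232)
    (hγ0 : 3 * γ ^ 3 - 12 * γ ^ 2 + 10 * γ - 2 = 0) (hm : 0 ≤ m) (hm' : m * γ ≤ 1)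
    {b : ℕ → ℝ} (hb0 : b 0 = 1) (hb : Antitone b) (hbn : ∀ n, 0 ≤ b n) (n : ℕ) :
    m * (1 - 3 * b (n + 1)) + (1 - m * γ) ≤ roundCost m b (n + 1) := by
  have hγp : 0 < γ := by linarith [hγ.1]
  -- `roundCost` is affine in `m`, and `m` is a convex combination of `γ⁻¹` and `0` with weights `m
  -- * γ` and `1 - m * γ`.
  have e : roundCost m b (n + 1)
      = m * (γ * roundCost γ⁻¹ b (n + 1)) + (1 - m * γ) * roundCost 0 b (n + 1) := by
    simp only [roundCost, Finset.mul_sum, ← Finset.sum_add_distrib]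
    refine Finset.sum_congr rfl fun k _ => ?_
    field_simp
    ring
  rw [e]
  exact add_le_add (mul_le_mul_of_nonneg_left (roundCost_inv_ge hγ hγ0 hb0 hb hbn n) hm)
    (le_mul_of_one_le_right (by linarith) (roundCost_zero_ge hb0 hb hbn n))

/-- A bound `j` for all partial costs of a round is at least `m + (1 - m * γ)`, whatever `b` is. -/
theorem le_of_roundCost_le {γ m j : ℝ} (hγ : γ ∈ Set.Ioo (0.2997231 : ℝ) 0.2997232)
    (hγ0 : 3 * γ ^ 3 - 12 * γ ^ 2 + 10 * γ - 2 = 0) (hm : 0 ≤ m) (hm' : m * γ ≤ 1)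
    {b : ℕ → ℝ} (hb0 : b 0 = 1) (hb : Antitone b) (hbn : ∀ n, 0 ≤ b n)
    (hj : ∀ n, roundCost m b n ≤ j) : m + (1 - m * γ) ≤ j := by
  have hlim : Filter.Tendsto (fun n : ℕ => j + 3 * m * (j / ((n : ℝ) + 1))) Filter.atTop
      (nhds (j + 3 * m * 0)) := by
    refine Filter.Tendsto.const_add _ (Filter.Tendsto.const_mul _ ?_)
    simpa [div_eq_mul_inv] using
      (tendsto_one_div_add_atTop_nhds_zero_nat (𝕜 := ℝ)).const_mul j
  rw [mul_zero, add_zero] at hlim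
  refine ge_of_tendsto' hlim fun n => ?_
  have h1 := (roundCost_ge hγ hγ0 hm hm' hb0 hb hbn n).trans (hj (n + 1))
  -- A bounded round cost forces `b` to tend to zero, which removes the error term `3 * b (n + 1)`.
  have h2 : b (n + 1) ≤ j / ((n : ℝ) + 1) := by
    rw [le_div_iff₀ (by positivity), mul_comm]
    exact_mod_cast (roundCost_ge_mul hm hb0 hb hbn (n + 1)).trans (hj (n + 1))
  nlinarith [mul_le_mul_of_nonneg_left h2 hm]

/-! ### Lower bound for all policies -/

/-- The expected remaining time of two devices with the common history `w`. -/
noncomputable def joint (f : Policy) (w : List Response) : ℝ≥0∞ := remaining f (w, w)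

/-- A lower bound for the expected remaining time of a device with history `w` when the other
device has succeeded. -/
noncomputable def solo (f : Policy) (w : List Response) : ℝ≥0∞ :=
  ⨅ (x : List Response) (_ : .success ∈ x), min (remaining f (x, w)) (remaining f (w, x))

theorem solo_le_left (f : Policy) {x : List Response} (hx : .success ∈ x) (w : List Response) :
    solo f w ≤ remaining f (x, w) :=
  (iInf₂_le x hx).trans (min_le_left _ _)

theorem solo_le_right (f : Policy) {x : List Response} (hx : .success ∈ x) (w : List Response) :
    solo f w ≤ remaining f (w, x) :=
  (iInf₂_le x hx).trans (min_le_right _ _)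

theorem joint_ge (f : Policy) {w : List Response} (hw : .success ∉ w) :
    1 + toNNReal (f.prob w) ^ 2 * joint f (w ++ [.collision])
      + 2 * toNNReal (f.prob w) * toNNReal (σ (f.prob w)) * solo f (w ++ [.idle])
      + toNNReal (σ (f.prob w)) ^ 2 * joint f (w ++ [.idle]) ≤ joint f w := by
  have hs : .success ∈ w ++ [Response.success] := by simp
  have hc : slotCost (w, w) = 1 := by simp [slotCost, hw]
  rw [show joint f w = remaining f (w, w) from rfl, remaining_eq f (w, w), hc, transition]
  calc _ = 1 + (toNNReal (f.prob w) * (toNNReal (f.prob w) * joint f (w ++ [.collision])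
            + toNNReal (σ (f.prob w)) * solo f (w ++ [.idle]))
          + toNNReal (σ (f.prob w)) * (toNNReal (f.prob w) * solo f (w ++ [.idle])
            + toNNReal (σ (f.prob w)) * joint f (w ++ [.idle])) : ℝ≥0∞) := by ring
    _ ≤ _ := by
      refine add_le_add le_rfl (add_le_add
        (mul_le_mul_right (add_le_add le_rfl (mul_le_mul_right ?_ _)) _)
        (mul_le_mul_right (add_le_add (mul_le_mul_right ?_ _) le_rfl) _))
      · exact solo_le_left f hs _
      · exact solo_le_right f hs _

/-- The finished device stays silent and keeps its success, so its history remains admissible in the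
infimum. -/
theorem solo_ge (f : Policy) {w : List Response} (hw : .success ∉ w) :
    1 + toNNReal (σ (f.prob w)) * solo f (w ++ [.idle]) ≤ solo f w := by
  refine le_iInf₂ fun x hx => le_min ?_ ?_
  · have hc : slotCost (x, w) = 1 := by simp [slotCost, hw]
    rw [remaining_eq f (x, w), hc, transition, f.halts x hx]
    simp only [toNNReal_zero, ENNReal.coe_zero, zero_mul, zero_add, symm_zero, toNNReal_one,
      ENNReal.coe_one, one_mul]
    exact add_le_add le_rfl (le_add_left (mul_le_mul_right (solo_le_left f (by simp [hx]) _) _))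
  · have hc : slotCost (w, x) = 1 := by simp [slotCost, hw]
    rw [remaining_eq f (w, x), hc, transition, f.halts x hx]
    simp only [toNNReal_zero, ENNReal.coe_zero, zero_mul, zero_add, symm_zero, toNNReal_one,
      ENNReal.coe_one, one_mul]
    exact add_le_add le_rfl (le_add_left (mul_le_mul_right (solo_le_right f (by simp [hx]) _) _))

/-- Unrolling the recursions for two devices and for one device along a round. -/
theorem sum_le_of_recursion {j k p q b a : ℕ → ℝ≥0∞} {m : ℝ≥0∞}
    (hj : ∀ n, 1 + p n ^ 2 * m + 2 * p n * q n * k (n + 1) + q n ^ 2 * j (n + 1) ≤ j n)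
    (hk : ∀ n, 1 + q n * k (n + 1) ≤ k n)
    (hb0 : b 0 = 1) (ha0 : a 0 = 0) (hb : ∀ n, b (n + 1) = b n * q n)
    (ha : ∀ n, a (n + 1) = a n + b n * p n) (n : ℕ) :
    ∑ i ∈ Finset.range n, (b i ^ 2 + 2 * a i * b i + (b i * p i) ^ 2 * m) ≤ j 0 := by
  -- `b n ^ 2` weighs the case of two silent devices, `2 * a n * b n` that of exactly one. The
  -- latter weight also collects the new term `2 * p n * q n`.
  have key : ∑ i ∈ Finset.range n, (b i ^ 2 + 2 * a i * b i + (b i * p i) ^ 2 * m)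
      + (b n ^ 2 * j n + 2 * a n * b n * k n) ≤ j 0 := by
    induction n with
    | zero => simp [hb0, ha0]
    | succ n ih =>
      refine le_trans ?_ ih
      rw [Finset.sum_range_succ, add_assoc]
      refine add_le_add le_rfl ?_
      calc _ = b n ^ 2 * (1 + p n ^ 2 * m + 2 * p n * q n * k (n + 1) + q n ^ 2 * j (n + 1))
            + 2 * a n * b n * (1 + q n * k (n + 1)) := by
            rw [hb, ha]
            ring
        _ ≤ _ := add_le_add (mul_le_mul_right (hj n) _) (mul_le_mul_right (hk n) _)
  exact le_self_add.trans key

/-- The probability that a device with history `w` idles in the next `n` slots, if it receives the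
response `idle`. -/
noncomputable def idleProb (f : Policy) (w : List Response) (n : ℕ) : NNReal :=
  ∏ i ∈ Finset.range n, toNNReal (σ (f.prob (w ++ List.replicate i .idle)))

theorem idleProb_succ (f : Policy) (w : List Response) (n : ℕ) :
    idleProb f w (n + 1)
      = idleProb f w n * toNNReal (σ (f.prob (w ++ List.replicate n .idle))) :=
  Finset.prod_range_succ _ _

theorem toNNReal_le_one (x : I) : toNNReal x ≤ 1 := x.2.2

theorem idleProb_antitone (f : Policy) (w : List Response) : Antitone (idleProb f w) :=
  antitone_nat_of_succ_le fun n => by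
    rw [idleProb_succ]
    exact mul_le_of_le_one_right' (toNNReal_le_one _)

theorem idleProb_le_one (f : Policy) (w : List Response) (n : ℕ) : idleProb f w n ≤ 1 := by
  simpa [idleProb] using idleProb_antitone f w (Nat.zero_le n)

theorem roundCost_le_joint (f : Policy) {m : NNReal}
    (hm : ∀ w, .success ∉ w → (m : ℝ≥0∞) ≤ joint f w) {w : List Response} (hw : .success ∉ w)
    (n : ℕ) : ENNReal.ofReal (roundCost m (fun n => idleProb f w n) n) ≤ joint f w := by
  have hwn : ∀ n, .success ∉ w ++ List.replicate n Response.idle := fun n => by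
    simp [hw, List.mem_replicate]
  have hsucc : ∀ n, w ++ List.replicate n Response.idle ++ [.idle]
      = w ++ List.replicate (n + 1) .idle := fun n => by
    rw [List.replicate_succ', List.append_assoc]
  set p : ℕ → NNReal := fun n => toNNReal (f.prob (w ++ List.replicate n .idle)) with hp
  set q : ℕ → NNReal := fun n => toNNReal (σ (f.prob (w ++ List.replicate n .idle))) with hq
  have hpq : ∀ n, p n + q n = 1 := fun n => toNNReal_add_toNNReal_symm _
  have hpq' : ∀ n, (p n : ℝ) = 1 - q n := fun n => by
    have : (p n : ℝ) + q n = 1 := by exact_mod_cast hpq n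
    linarith
  have hb : ∀ n, idleProb f w (n + 1) = idleProb f w n * q n := idleProb_succ f w
  have ha : ∀ n, 1 - idleProb f w (n + 1)
      = (1 - idleProb f w n) + idleProb f w n * p n := fun n => by
    rw [← NNReal.coe_inj, NNReal.coe_add, NNReal.coe_sub (idleProb_le_one f w _),
      NNReal.coe_sub (idleProb_le_one f w _), hb, NNReal.coe_mul, NNReal.coe_mul, hpq']
    push_cast
    ring
  have key := sum_le_of_recursion (j := fun n => joint f (w ++ List.replicate n .idle))
    (k := fun n => solo f (w ++ List.replicate n .idle)) (p := fun n => p n) (q := fun n => q n)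
    (b := fun n => idleProb f w n) (a := fun n => ((1 - idleProb f w n : NNReal) : ℝ≥0∞)) (m := m)
    (fun n => by
      refine le_trans ?_ (joint_ge f (hwn n))
      rw [hsucc]
      -- After a collision the common history is still success-free, so a new round costs at least
      -- `m`.
      refine add_le_add (add_le_add (add_le_add le_rfl (mul_le_mul_right (hm _ ?_) _)) le_rfl)
        le_rfl
      simp [hw, List.mem_replicate])
    (fun n => by
      have := solo_ge f (hwn n)
      rwa [hsucc] at this)
    (by simp [idleProb]) (by simp [idleProb]) (fun n => by simp only [hb, ENNReal.coe_mul])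
    (fun n => by simp only [ha, ENNReal.coe_mul, ENNReal.coe_add]) n
  simp only [List.replicate_zero, List.append_nil] at key
  refine le_trans (le_of_eq ?_) key
  have hround : roundCost m (fun n => idleProb f w n) n
      = ((∑ i ∈ Finset.range n, (idleProb f w i ^ 2
          + 2 * (1 - idleProb f w i) * idleProb f w i
          + (idleProb f w i * p i) ^ 2 * m) : NNReal) : ℝ) := by
    rw [roundCost, NNReal.coe_sum]
    refine Finset.sum_congr rfl fun i _ => ?_
    push_cast [NNReal.coe_sub (idleProb_le_one f w i), hb, hpq']
    ring
  rw [hround, ENNReal.ofReal_coe_nnreal]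
  push_cast
  rfl

/-- Every policy needs at least `1 / γ` slots in expectation. -/
theorem expectedCost_ge {γ : ℝ} (hγ : γ ∈ Set.Ioo (0.2997231 : ℝ) 0.2997232)
    (hγ0 : 3 * γ ^ 3 - 12 * γ ^ 2 + 10 * γ - 2 = 0) (f : Policy) :
    ENNReal.ofReal (1 / γ) ≤ expectedCost maxObjective f := by
  have hγp : 0 < γ := by linarith [hγ.1]
  rw [expectedCost_eq_remaining]
  set M : ℝ≥0∞ := ⨅ (w : List Response) (_ : .success ∉ w), joint f w with hM
  have hMle : ∀ w, .success ∉ w → M ≤ joint f w := fun w hw => iInf₂_le w hw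
  refine le_trans ?_ (hMle [] (by simp))
  by_contra! hlt
  lift M to NNReal using hlt.ne_top with m
  have hm1 : (m : ℝ) < 1 / γ := by
    rwa [← ENNReal.ofReal_coe_nnreal, ENNReal.ofReal_lt_ofReal_iff (by positivity)] at hlt
  have hm' : m * γ < 1 := by rwa [lt_div_iff₀ hγp] at hm1
  -- The round bound holds at every success-free history, hence for their infimum `m`, and improves
  -- it by `1 - m * γ > 0`.
  have hle : ENNReal.ofReal (m + (1 - m * γ)) ≤ m := by
    rw [hM]
    refine le_iInf₂ fun w hw => ?_
    by_cases hJ : joint f w = ∞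
    · simp [hJ]
    lift joint f w to NNReal using hJ with j hj
    rw [← ENNReal.ofReal_coe_nnreal]
    refine ENNReal.ofReal_le_ofReal (le_of_roundCost_le hγ hγ0 m.2 hm'.le
      (b := fun n => idleProb f w n) (by simp [idleProb])
      (fun _ _ h => NNReal.coe_le_coe.2 (idleProb_antitone f w h)) (fun n => NNReal.coe_nonneg _)
      fun n => ?_)
    have := roundCost_le_joint f hMle hw n
    rw [← hj, ← ENNReal.ofReal_coe_nnreal] at this
    exact (ENNReal.ofReal_le_ofReal_iff j.2).1 this
  rw [← ENNReal.ofReal_coe_nnreal] at hle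
  linarith [(ENNReal.ofReal_le_ofReal_iff (NNReal.coe_nonneg m)).1 hle]

/-! ### The three-step protocol -/

theorem Step.run_append (s : Step) (w : List Response) (r : Response) :
    Step.run s (w ++ [r]) = Step.next (Step.run s w) r := by
  simp [Step.run]

theorem Step.success_mem_of_run_eq_halted {w : List Response}
    (h : Step.run .step1 w = .halted) : .success ∈ w := by
  induction w using List.reverseRecOn with
  | nil => simp [Step.run] at h
  | append_singleton w r ih =>
    rw [Step.run_append] at h
    rcases r with _ | _ | _
    · rcases hs : Step.run .step1 w with _ | _ | _ | _ <;> simp [hs, Step.next] at h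
      simp [ih hs]
    · simp
    · rcases hs : Step.run .step1 w with _ | _ | _ | _ <;> simp [hs, Step.next] at h
      simp [ih hs]

/-- The expected remaining time of the protocol in a pair of states, and `⊤` for the pairs that are
not reached. -/
noncomputable def protocolCost (β J₁ J₂ J₃ : ℝ) : Step → Step → ℝ≥0∞
  | .step1, .step1 => ENNReal.ofReal J₁
  | .step2, .step2 => ENNReal.ofReal J₂
  | .step3, .step3 => ENNReal.ofReal J₃
  | .halted, .step2 => ENNReal.ofReal (2 - β)
  | .step2, .halted => ENNReal.ofReal (2 - β)
  | .halted, .step3 => 1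
  | .step3, .halted => 1
  | .halted, .halted => 0
  | _, _ => ⊤

theorem toNNReal_eq_ofReal (x : I) : (toNNReal x : ℝ≥0∞) = ENNReal.ofReal x := by
  rw [← coe_toNNReal, ENNReal.ofReal_coe_nnreal]

theorem ofReal_two_device_step {p q A B C : ℝ} (hp : 0 ≤ p) (hq : 0 ≤ q) (hA : 0 ≤ A) (hB : 0 ≤ B)
    (hC : 0 ≤ C) :
    1 + (ENNReal.ofReal p * (ENNReal.ofReal p * ENNReal.ofReal A
          + ENNReal.ofReal q * ENNReal.ofReal B)
        + ENNReal.ofReal q * (ENNReal.ofReal p * ENNReal.ofReal B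
          + ENNReal.ofReal q * ENNReal.ofReal C))
      = ENNReal.ofReal (1 + p ^ 2 * A + 2 * p * q * B + q ^ 2 * C) := by
  rw [← ENNReal.ofReal_one]
  repeat first
    | rw [← ENNReal.ofReal_mul (by positivity)]
    | rw [← ENNReal.ofReal_add (by positivity) (by positivity)]
  congr 1
  ring

theorem expectedCost_protocol_le {α β : I} {J₁ J₂ J₃ : ℝ} (h₁ : 0 ≤ J₁) (h₂ : 0 ≤ J₂) (h₃ : 0 ≤ J₃)
    (e₁ : 1 + (α : ℝ) ^ 2 * J₁ + 2 * α * (1 - α) * (2 - β) + (1 - (α : ℝ)) ^ 2 * J₂ ≤ J₁)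
    (e₂ : 1 + (β : ℝ) ^ 2 * J₁ + 2 * β * (1 - β) * 1 + (1 - (β : ℝ)) ^ 2 * J₃ ≤ J₂)
    (e₃ : 1 + J₁ ≤ J₃) :
    expectedCost maxObjective (threeStepProtocol α β) ≤ ENNReal.ofReal J₁ := by
  rw [expectedCost_eq_remaining]
  refine remaining_le_of_superharmonic (threeStepProtocol α β)
    (v := fun h => protocolCost β J₁ J₂ J₃ (Step.run .step1 h.1) (Step.run .step1 h.2)) ?_ ([], [])
  rintro ⟨x, y⟩
  have hα := α.2
  have hβ := β.2
  have hcost : slotCost (x, y) ≤ 1 := by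
    unfold slotCost
    split_ifs <;> simp
  have hone : 1 + ENNReal.ofReal (1 - β) ≤ ENNReal.ofReal (2 - β) := by
    rw [← ENNReal.ofReal_one, ← ENNReal.ofReal_add zero_le_one (by linarith [hβ.2])]
    exact ENNReal.ofReal_le_ofReal (by linarith)
  simp only [transition, threeStepProtocol, Step.run_append]
  -- Pairs with value `⊤` are trivial; from the other pairs they are entered only with weight `0`,
  -- and `0 * ⊤ = 0`.
  rcases hx : Step.run .step1 x with _ | _ | _ | _ <;>
    rcases hy : Step.run .step1 y with _ | _ | _ | _ <;>
    simp only [Step.next, Step.transmitProb, protocolCost, le_top, toNNReal_eq_ofReal, coe_symm_eq]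
  · refine (add_le_add hcost le_rfl).trans ?_
    rw [ofReal_two_device_step hα.1 (by linarith [hα.2]) h₁ (by linarith [hβ.2]) h₂]
    exact ENNReal.ofReal_le_ofReal e₁
  · refine (add_le_add hcost le_rfl).trans ?_
    have := ofReal_two_device_step hβ.1 (sub_nonneg.2 hβ.2) h₁ zero_le_one h₃
    rw [ENNReal.ofReal_one] at this
    rw [this]
    exact ENNReal.ofReal_le_ofReal e₂
  · simpa using (add_le_add hcost le_rfl).trans hone
  · refine (add_le_add hcost le_rfl).trans ?_
    simp
    rw [← ENNReal.ofReal_one, ← ENNReal.ofReal_add zero_le_one h₁]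
    exact ENNReal.ofReal_le_ofReal e₃
  · simpa using hcost
  · simpa using (add_le_add hcost le_rfl).trans hone
  · simpa using hcost
  · have h1 := Step.success_mem_of_run_eq_halted hx
    have h2 := Step.success_mem_of_run_eq_halted hy
    simp [slotCost, h1, h2]

theorem expectedCost_optimal_protocol_le {α β : I} {γ : ℝ}
    (hα : (α : ℝ) ^ 3 + 7 * (α : ℝ) ^ 2 - 21 * (α : ℝ) + 9 = 0)
    (hβ : 4 * (β : ℝ) ^ 3 - 8 * (β : ℝ) ^ 2 + 3 = 0)
    (hγ : γ ∈ Set.Ioo (0.2997231 : ℝ) 0.2997232)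
    (hγ0 : 3 * γ ^ 3 - 12 * γ ^ 2 + 10 * γ - 2 = 0) :
    expectedCost maxObjective (threeStepProtocol α β) ≤ ENNReal.ofReal (1 / γ) := by
  have hγp : 0 < γ := by linarith [hγ.1]
  have hβ1 : (0 : ℝ) ≤ 1 - β := by linarith [β.2.2]
  have hβ0 : (0 : ℝ) ≤ β := β.2.1
  have ha := alpha_eq α.2 hα hγ hγ0
  have hb := beta_eq β.2 hβ hγ hγ0
  refine expectedCost_protocol_le
    (J₂ := 1 + (β : ℝ) ^ 2 * (1 / γ) + 2 * β * (1 - β) * 1 + (1 - (β : ℝ)) ^ 2 * (1 + 1 / γ))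
    (J₃ := 1 + 1 / γ) (by positivity) (by positivity) (by positivity) ?_ le_rfl le_rfl
  -- This is the optimal second step `(b - γ) / (2 - γ)` at `b = 1 - α`, as `2 - 7 * γ + 3 * γ ^ 2 =
  -- (2 - γ) * (1 - 3 * γ)`.
  have h12 : (1 - (α : ℝ)) * (1 - β) = 1 - 3 * γ := by
    rw [ha, hb]
    linear_combination (3 / 2 - 3 / 2 * γ) * hγ0
  have h1 : 1 - (α : ℝ) = 2 - 6 * γ + 3 * γ ^ 2 := by rw [ha]; ring
  have e : 1 + (α : ℝ) ^ 2 * (1 / γ) + 2 * α * (1 - α) * (2 - β) + (1 - (α : ℝ)) ^ 2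
        * (1 + (β : ℝ) ^ 2 * (1 / γ) + 2 * β * (1 - β) * 1 + (1 - (β : ℝ)) ^ 2 * (1 + 1 / γ))
      = 1 + (1 - (1 - (α : ℝ))) ^ 2 * (1 / γ)
        + 2 * (1 - (1 - (α : ℝ))) * ((1 - α) + (1 - α) * (1 - β))
        + (1 - (α : ℝ)) ^ 2 + ((1 - (α : ℝ)) - (1 - α) * (1 - β)) ^ 2 * (1 / γ)
        + 2 * ((1 - (α : ℝ)) - (1 - α) * (1 - β)) * ((1 - α) * (1 - β))
        + ((1 - (α : ℝ)) * (1 - β)) ^ 2 * (1 + 1 / γ) := by ring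
  rw [e, h12, h1]
  refine le_of_eq ?_
  field_simp
  linear_combination (-1 + 6 * γ - 3 * γ ^ 2) * hγ0

end ContentionResolution

open ContentionResolution in
theorem mainTheorem2 :
    (∃! x : ℝ, x ∈ Set.Icc (0 : ℝ) 1 ∧ x ^ 3 + 7 * x ^ 2 - 21 * x + 9 = 0) ∧
    (∃! x : ℝ, x ∈ Set.Icc (0 : ℝ) 1 ∧ 4 * x ^ 3 - 8 * x ^ 2 + 3 = 0) ∧
    (∃! x : ℝ, x ∈ Set.Icc (1 / 4 : ℝ) (1 / 3) ∧ 3 * x ^ 3 - 12 * x ^ 2 + 10 * x - 2 = 0) ∧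
    ∀ (α β : unitInterval) (γ : ℝ),
      (α : ℝ) ^ 3 + 7 * (α : ℝ) ^ 2 - 21 * (α : ℝ) + 9 = 0 →
      4 * (β : ℝ) ^ 3 - 8 * (β : ℝ) ^ 2 + 3 = 0 →
      γ ∈ Set.Icc (1 / 4 : ℝ) (1 / 3) →
      3 * γ ^ 3 - 12 * γ ^ 2 + 10 * γ - 2 = 0 →
      IsOptimal maxObjective (threeStepProtocol α β) ∧
      expectedCost maxObjective (threeStepProtocol α β) = ENNReal.ofReal (1 / γ) ∧
      |(α : ℝ) - 0.528837| < 0.0000005 ∧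
      |(β : ℝ) - 0.785997| < 0.0000005 ∧
      |γ - 0.299723| < 0.0000005 ∧
      |1 / γ - 3.33641| < 0.000005 := by
  refine ⟨existsUnique_alpha, existsUnique_beta, existsUnique_gamma,
    fun α β γ hα hβ hγ hγ0 => ?_⟩
  have hγ' := gamma_mem_Ioo hγ hγ0
  have hγp : 0 < γ := by linarith [hγ'.1]
  have hub := expectedCost_optimal_protocol_le hα hβ hγ' hγ0
  refine ⟨fun g => hub.trans (expectedCost_ge hγ' hγ0 g),
    le_antisymm hub (expectedCost_ge hγ' hγ0 _), alpha_approx α.2 hα, beta_approx β.2 hβ,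
    ?_, ?_⟩
  · rw [abs_lt]
    constructor <;> linarith [hγ'.1, hγ'.2]
  · rw [abs_lt, neg_lt_sub_iff_lt_add, sub_lt_iff_lt_add, div_lt_iff₀ hγp, ← sub_lt_iff_lt_add',
      lt_div_iff₀ hγp]
    constructor <;> linarith [hγ'.1, hγ'.2]
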